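/- **Corollary (Hyperbolic generator).** Let $\eta_1,\eta_2,\sigma_1,\sigma_2>0$, $\rho\in(-1,1)$, $\nu>0$ and $g_c(x)=\exp(-\nu\sqrt{1+x})$. For $0<w_i<1$ put $t_i=-\log(1-w_i)$ and $\widetilde w_i=\log\big[(t_i/\eta_i)^{1/\sigma_i}\big]$, $i=1,2$. Let $\boldsymbol W=(W_1,W_2)^\top$ have the bivariate unit-log-hyperbolic distribution, that is, let $\boldsymbol W$ be a random vector with joint density $$f_{W_1,W_2}(w_1,w_2)=\frac{1}{(1-w_1)t_1\sigma_1(1-w_2)t_2\sigma_2\sqrt{1-\rho^2}\,Z_{g_c}}\;g_c\!\left(\frac{\widetilde w_1^2-2\rho\widetilde w_1\widetilde w_2+\widetilde w_2^2}{1-\rho^2}\right),\qquad 0<w_1,w_2<1,$$ and density $0$ elsewhere, where the normalizing constant is $$Z_{g_c}=\int_0^\infty\!\!\int_0^\infty \frac{1}{t_1t_2\sigma_1\sigma_2\sqrt{1-\rho^2}}\;g_c\!\left(\frac{\widetilde t_1^{\,2}-2\rho\widetilde t_1\widetilde t_2+\widetilde t_2^{\,2}}{1-\rho^2}\right)dt_1\,dt_2,\qquad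 \widetilde t_i=\log\big[(t_i/\eta_i)^{1/\sigma_i}\big].$$ For $\lambda\in\mathbb R$ and $\alpha,\delta>0$ let $$f_{\rm GH}(x;\lambda,\alpha,\delta)=\frac{(\alpha/\delta)^\lambda}{\sqrt{2\pi}\,K_\lambda(\delta\alpha)}\,\frac{K_{\lambda-1/2}\big(\alpha\sqrt{\delta^2+x^2}\big)}{\big(\sqrt{\delta^2+x^2}/\alpha\big)^{1/2-\lambda}},\quad x\in\mathbb R,\qquad F_{\rm GH}(C;\lambda,\alpha,\delta)=\int_C f_{\rm GH}(x;\lambda,\alpha,\delta)\,dx,$$ be the generalized hyperbolic density and its distribution function on Borel sets $C\subseteq\mathbb R$, where $K_\lambda(u)=\frac12(u/2)^\lambda\int_0^\infty t^{-\lambda-1}\exp\big(-t-\tfrac{u^2}{4t}\big)\,dt$, $u>0$. Let ${\rm GH}(\lambda,\alpha,\delta)$ be the law on $\mathbb R$ with density $f_{\rm GH}(\cdot\,;\lambda,\alpha,\delta)$. For $-1<r<1$, $B\subseteq(0,1)$ and $0<w_1<1$ put $$B_r=\left\{\frac{1}{\sqrt{1-r^2}}\,\widetilde w_2-\frac{r}{\sqrt{1-r^2}}\,\widetilde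 w_1:\ w_2\in B\right\}.$$ 1. For every Borel set $B\subseteq(0,1)$ with $\mathbb P(W_2\in B)>0$, the conditional law of $W_1$ given $W_2\in B$ has the density $$f_{W_1}(w_1\mid W_2\in B)=\frac{1}{(1-w_1)t_1\sigma_1}\;f_{\rm GH}(\widetilde w_1;3/2,\nu,1)\;\frac{F_{\rm GH}\big(B_\rho;1,\nu,\sqrt{1+\widetilde w_1^2}\big)}{F_{\rm GH}(B_0;3/2,\nu,1)},\qquad 0<w_1<1,$$ and $0$ elsewhere. 2. Writing $\widetilde W_i=\log\big[(-\log(1-W_i)/\eta_i)^{1/\sigma_i}\big]$, both $\widetilde W_1$ and $\widetilde W_2$ have the law ${\rm GH}(3/2,\nu,1)$, and for almost every $x$ (with respect to the law of $\widetilde W_1$) the conditional law of $(\widetilde W_2-\rho\widetilde W_1)/\sqrt{1-\rho^2}$ given $\widetilde W_1=x$ is ${\rm GH}(1,\nu,\sqrt{1+x^2})$. -/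

import Mathlib

open MeasureTheory ProbabilityTheory Set

noncomputable section

namespace BULS

/-- The parameter vector `θ = (η₁, η₂, σ₁, σ₂, ρ)`, with `ηᵢ > 0` (equivalently `ηᵢ = exp μᵢ` for a
real `μᵢ`), `σᵢ > 0` and `ρ ∈ (-1, 1)`. -/
structure Param where
  η₁ : ℝ
  η₂ : ℝ
  σ₁ : ℝ
  σ₂ : ℝ
  ρ : ℝ
  η₁_pos : 0 < η₁
  η₂_pos : 0 < η₂
  σ₁_pos : 0 < σ₁
  σ₂_pos : 0 < σ₂
  ρ_mem : ρ ∈ Ioo (-1 : ℝ) 1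

/-- `(x² - 2ρxy + y²) / (1 - ρ²)`. -/
def quadForm (ρ x y : ℝ) : ℝ := (x ^ 2 - 2 * ρ * x * y + y ^ 2) / (1 - ρ ^ 2)

/-- The standardized logarithm `log ((t / η) ^ (1 / σ))`. -/
def stdLog (η σ t : ℝ) : ℝ := Real.log ((t / η) ^ (1 / σ))

/-- `t = -log (1 - w)`. -/
def tOf (w : ℝ) : ℝ := -Real.log (1 - w)

/-- `w̃ = log ((t / η) ^ (1 / σ))`, where `t = -log (1 - w)`. -/
def tilde (η σ w : ℝ) : ℝ := stdLog η σ (tOf w)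

/-- The partition function `Z_g`: the integral over the positive quadrant of the unnormalized
bivariate log-symmetric density. -/
def partitionFn (θ : Param) (g : ℝ → ℝ) : ℝ :=
  ∫ t₁ in Ioi (0 : ℝ), ∫ t₂ in Ioi (0 : ℝ),
    1 / (t₁ * t₂ * θ.σ₁ * θ.σ₂ * Real.sqrt (1 - θ.ρ ^ 2)) *
      g (quadForm θ.ρ (stdLog θ.η₁ θ.σ₁ t₁) (stdLog θ.η₂ θ.σ₂ t₂))

/-- The BULS joint density on the open unit square, extended by zero. -/
def jointPDF (θ : Param) (g : ℝ → ℝ) : ℝ × ℝ → ℝ :=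
  indicator (Ioo (0 : ℝ) 1 ×ˢ Ioo (0 : ℝ) 1) fun w =>
    1 / ((1 - w.1) * tOf w.1 * θ.σ₁ * ((1 - w.2) * tOf w.2 * θ.σ₂) *
        Real.sqrt (1 - θ.ρ ^ 2) * partitionFn θ g) *
      g (quadForm θ.ρ (tilde θ.η₁ θ.σ₁ w.1) (tilde θ.η₂ θ.σ₂ w.2))

/-- `(W₁, W₂) ∼ BULS(θ, g)`: the law of `(W₁, W₂)` has density `jointPDF θ g` with respect to
Lebesgue measure on the plane. -/
def IsBULS {Ω : Type*} [MeasurableSpace Ω] (P : Measure Ω) (W₁ W₂ : Ω → ℝ)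
    (θ : Param) (g : ℝ → ℝ) : Prop :=
  P.map (fun ω => (W₁ ω, W₂ ω)) =
    (volume : Measure (ℝ × ℝ)).withDensity fun w => ENNReal.ofReal (jointPDF θ g w)

/-- The generator `x ↦ exp (-ν √(1 + x))` of the bivariate unit-log-hyperbolic distribution. -/
def hypGen (ν x : ℝ) : ℝ := Real.exp (-ν * Real.sqrt (1 + x))

/-- The modified Bessel function of the third kind `K_r(u)`, for real index `r` and `u > 0`. -/
def besselK (r u : ℝ) : ℝ :=
  1 / 2 * (u / 2) ^ r * ∫ t in Ioi (0 : ℝ), t ^ (-r - 1) * Real.exp (-t - u ^ 2 / (4 * t))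

/-- The generalized hyperbolic density `f_GH(x; l, α, δ)`, for `l ∈ ℝ`, `α > 0`, `δ > 0`. -/
def ghPDF (l α δ x : ℝ) : ℝ :=
  (Real.sqrt (α ^ 2) / δ) ^ l /
      (Real.sqrt (2 * Real.pi) * besselK l (δ * Real.sqrt (α ^ 2))) *
    (besselK (l - 1 / 2) (α * Real.sqrt (δ ^ 2 + x ^ 2)) /
      (Real.sqrt (δ ^ 2 + x ^ 2) / α) ^ (1 / 2 - l))

/-- `F_GH(C; l, α, δ) = ∫_C f_GH(x; l, α, δ) dx`. -/
def ghF (C : Set ℝ) (l α δ : ℝ) : ℝ := ∫ x in C, ghPDF l α δ x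

/-- The law `GH(l, α, δ)` on the real line. -/
def ghLaw (l α δ : ℝ) : Measure ℝ :=
  (volume : Measure ℝ).withDensity fun x => ENNReal.ofReal (ghPDF l α δ x)

/-- The set `B_r = (1/√(1-r²)) log[(-log(1-B)/η₂)^{1/σ₂}] - (r/√(1-r²)) x`, for the value `x` of
`w̃₁`. -/
def transSet (θ : Param) (r x : ℝ) (B : Set ℝ) : Set ℝ :=
  (fun w => 1 / Real.sqrt (1 - r ^ 2) * tilde θ.η₂ θ.σ₂ w - r / Real.sqrt (1 - r ^ 2) * x) '' B

/-- The claimed density of `W₁` given `W₂ ∈ B` on `(0, 1)`, extended by zero. -/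
def hypCondPDF (θ : Param) (ν : ℝ) (B : Set ℝ) : ℝ → ℝ :=
  indicator (Ioo (0 : ℝ) 1) fun w₁ =>
    1 / ((1 - w₁) * tOf w₁ * θ.σ₁) *
      ghPDF (3 / 2) ν 1 (tilde θ.η₁ θ.σ₁ w₁) *
      (ghF (transSet θ θ.ρ (tilde θ.η₁ θ.σ₁ w₁) B) 1 ν
          (Real.sqrt (1 + tilde θ.η₁ θ.σ₁ w₁ ^ 2)) /
        ghF (transSet θ 0 (tilde θ.η₁ θ.σ₁ w₁) B) (3 / 2) ν 1)

end BULS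

end

noncomputable section

namespace BULS

/-! ### The integral representation of the Bessel function -/

/-! The heart is a factorization of the elliptical hyperbolic density into marginal times
conditional. Reflecting `t ↦ u²/(4t)` in the Bessel integral gives `K_r(u) = ½ (u/2)^(-r) besselInt
r u`. All powers of `α` and `δ` then cancel, and the density at `x` becomes `α/(2√π)` times
`besselInt (l - 1/2) (α√(δ² + x²)) / besselInt l (αδ)` (`ghPDF_eq`). Total mass one is Tonelli plus
a Gaussian integral (`lintegral_besselInt`).

In the product of the densities for `(3/2, ν, 1)` at `x` and `(1, ν, √(1 + x²))` at `z`, the factor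
`besselInt 1 (ν√(1 + x²))` cancels. The remaining `besselInt (1/2)` is a pure exponential
(`besselInt_half`), so the product is a constant times `exp (-ν√(1 + x² + z²))` (`ghPDF_mul_ghPDF`).
Completing the square turns the quadratic form into `x² + z²` with `z = (y - ρx)/√(1 - ρ²)`, so this
product is the joint density of the standardized logarithms up to the Jacobian of `y ↦ z`. The
partition function is never computed: two proportional probability densities coincide
(`ofReal_hypGen_eq`).

The marginal and conditional laws follow by disintegration (`map_standardize`); the second marginal
uses the symmetry of the joint density. The density given `W₂ ∈ B` is Bayes' rule, with numerator
`IsBULS.measure_inter` and denominator `IsBULS.measure_preimage`. -/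

/-- The integral `∫₀^∞ t^(s-1) exp (-t - u²/(4t)) dt`. -/
def besselInt (s u : ℝ) : ℝ :=
  ∫ t in Ioi (0 : ℝ), t ^ (s - 1) * Real.exp (-t - u ^ 2 / (4 * t))

lemma measurable_besselIntegrand (s : ℝ) :
    Measurable fun p : ℝ × ℝ => p.2 ^ (s - 1) * Real.exp (-p.2 - p.1 ^ 2 / (4 * p.2)) := by
  fun_prop

/-- Dropping `u²/(4t) ≥ 0` from the exponent leaves the Gamma integrand as a dominating function. -/
lemma integrableOn_besselInt {s : ℝ} (hs : 0 < s) (u : ℝ) :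
    IntegrableOn (fun t : ℝ => t ^ (s - 1) * Real.exp (-t - u ^ 2 / (4 * t))) (Ioi 0) := by
  refine Integrable.mono' (Real.GammaIntegral_convergent hs)
    (by fun_prop : Measurable fun t : ℝ =>
      t ^ (s - 1) * Real.exp (-t - u ^ 2 / (4 * t))).aestronglyMeasurable ?_
  filter_upwards [ae_restrict_mem measurableSet_Ioi] with t ht
  have ht : 0 < t := ht
  rw [Real.norm_of_nonneg (by positivity), mul_comm]
  gcongr
  have : 0 ≤ u ^ 2 / (4 * t) := by positivity
  linarith

lemma besselInt_pos {s : ℝ} (hs : 0 < s) (u : ℝ) : 0 < besselInt s u := by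
  refine (setIntegral_pos_iff_support_of_nonneg_ae ?_ (integrableOn_besselInt hs u)).2 ?_
  · filter_upwards [ae_restrict_mem measurableSet_Ioi] with t ht
    have ht : 0 < t := ht
    positivity
  · have : Function.support (fun t : ℝ => t ^ (s - 1) * Real.exp (-t - u ^ 2 / (4 * t))) ∩ Ioi 0
        = Ioi 0 := by
      refine inter_eq_right.2 fun t ht => ?_
      have ht : 0 < t := ht
      exact (by positivity : t ^ (s - 1) * Real.exp (-t - u ^ 2 / (4 * t)) ≠ 0)
    rw [this]
    simp

lemma ofReal_besselInt {s : ℝ} (hs : 0 < s) (u : ℝ) :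
    ENNReal.ofReal (besselInt s u) = ∫⁻ t in Ioi (0 : ℝ),
      ENNReal.ofReal (t ^ (s - 1) * Real.exp (-t - u ^ 2 / (4 * t))) := by
  refine ofReal_integral_eq_lintegral_ofReal (integrableOn_besselInt hs u) ?_
  filter_upwards [ae_restrict_mem measurableSet_Ioi] with t ht
  have ht : 0 < t := ht
  positivity

lemma image_const_div_Ioi {c : ℝ} (hc : 0 < c) : (fun t : ℝ => c / t) '' Ioi 0 = Ioi 0 := by
  ext y
  constructor
  · rintro ⟨t, ht, rfl⟩
    exact div_pos hc ht
  · intro hy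
    exact ⟨c / y, div_pos hc hy, div_div_cancel₀ hc.ne'⟩

lemma injOn_const_div_Ioi {c : ℝ} (hc : 0 < c) : InjOn (fun t : ℝ => c / t) (Ioi 0) := by
  intro a ha b hb h
  have ha : a ≠ 0 := (mem_Ioi.1 ha).ne'
  have hb : b ≠ 0 := (mem_Ioi.1 hb).ne'
  simp only at h
  field_simp at h
  exact h.symm

lemma hasDerivAt_const_div (c : ℝ) {t : ℝ} (ht : t ≠ 0) :
    HasDerivAt (fun t : ℝ => c / t) (-c / t ^ 2) t := by
  exact ((hasDerivAt_const t c).div (hasDerivAt_id t) ht).congr_deriv (by simp)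

lemma besselIntegrand_comp_const_div (s : ℝ) {u t : ℝ} (hu : 0 < u) (ht : 0 < t) :
    |-(u ^ 2 / 4) / t ^ 2| • ((u ^ 2 / 4 / t) ^ (s - 1) *
        Real.exp (-(u ^ 2 / 4 / t) - u ^ 2 / (4 * (u ^ 2 / 4 / t)))) =
      (u ^ 2 / 4) ^ s * (t ^ (-s - 1) * Real.exp (-t - u ^ 2 / (4 * t))) := by
  have hc : 0 < u ^ 2 / 4 := by positivity
  have e1 : -(u ^ 2 / 4 / t) - u ^ 2 / (4 * (u ^ 2 / 4 / t)) = -t - u ^ 2 / (4 * t) := by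
    field_simp
    ring
  rw [e1, neg_div, abs_neg, abs_of_pos (by positivity), smul_eq_mul,
    Real.div_rpow hc.le ht.le, Real.rpow_sub_one hc.ne', Real.rpow_sub_one ht.ne',
    Real.rpow_sub_one ht.ne', Real.rpow_neg ht.le]
  have := Real.rpow_pos_of_pos ht s
  field_simp

/-- Substitution `t ↦ (u²/4)/t`, which exchanges the two terms of the exponent. The change of
variables formula needs no integrability, so the sign of `s` is free. -/
lemma besselInt_eq_neg (s : ℝ) {u : ℝ} (hu : 0 < u) :
    besselInt s u = (u ^ 2 / 4) ^ s * besselInt (-s) u := by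
  have hc : 0 < u ^ 2 / 4 := by positivity
  rw [besselInt, besselInt, ← integral_const_mul]
  nth_rw 1 [← image_const_div_Ioi hc]
  rw [integral_image_eq_integral_abs_deriv_smul measurableSet_Ioi
    (fun t ht => (hasDerivAt_const_div _ (mem_Ioi.1 ht).ne').hasDerivWithinAt)
    (injOn_const_div_Ioi hc)]
  exact setIntegral_congr_fun measurableSet_Ioi fun t ht =>
    besselIntegrand_comp_const_div s hu ht

lemma integrableOn_besselInt_neg {s u : ℝ} (hs : 0 < s) (hu : 0 < u) :
    IntegrableOn (fun t : ℝ => t ^ (-s - 1) * Real.exp (-t - u ^ 2 / (4 * t))) (Ioi 0) := by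
  have hc : 0 < u ^ 2 / 4 := by positivity
  have h := integrableOn_besselInt hs u
  rw [← image_const_div_Ioi hc, integrableOn_image_iff_integrableOn_abs_deriv_smul measurableSet_Ioi
    (fun t ht => (hasDerivAt_const_div _ (mem_Ioi.1 ht).ne').hasDerivWithinAt)
    (injOn_const_div_Ioi hc)] at h
  have h2 := (h.congr_fun (fun t ht => besselIntegrand_comp_const_div s hu ht)
    measurableSet_Ioi).const_mul ((u ^ 2 / 4) ^ s)⁻¹
  refine IntegrableOn.congr_fun h2 (fun t _ => ?_) measurableSet_Ioi
  exact inv_mul_cancel_left₀ (Real.rpow_pos_of_pos hc s).ne' _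

lemma besselK_eq (r : ℝ) {u : ℝ} (hu : 0 < u) :
    besselK r u = 1 / 2 * (u / 2) ^ (-r) * besselInt r u := by
  have hu2 : 0 < u / 2 := by positivity
  rw [besselInt_eq_neg r hu, besselK, besselInt,
    show u ^ 2 / 4 = (u / 2) ^ (2 : ℝ) by rw [Real.rpow_two]; ring, ← Real.rpow_mul hu2.le,
    mul_assoc, mul_assoc]
  congr 1
  rw [← mul_assoc ((u / 2) ^ (-r)), ← Real.rpow_add hu2]
  congr 2
  ring

/-! ### The closed form at index one half -/

lemma image_sqrt_sub_div {u : ℝ} (hu : 0 < u) :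
    (fun t : ℝ => √t - u / (2 * √t)) '' Ioi 0 = univ := by
  refine eq_univ_of_forall fun y => ?_
  have h0 : 0 < y ^ 2 + 2 * u := by positivity
  have hr : 0 < (y + √(y ^ 2 + 2 * u)) / 2 := by
    have : -y < √(y ^ 2 + 2 * u) := Real.lt_sqrt_of_sq_lt (by nlinarith)
    linarith
  -- The witness is the square of the positive root `r` of `r² - yr - u/2 = 0`, which is the
  -- equation `r - u/(2r) = y`.
  refine ⟨((y + √(y ^ 2 + 2 * u)) / 2) ^ 2, by simp only [mem_Ioi]; positivity, ?_⟩
  simp only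
  rw [Real.sqrt_sq hr.le, sub_eq_iff_eq_add, ← sub_eq_iff_eq_add', eq_div_iff (by positivity)]
  linear_combination (1 / 2 : ℝ) * Real.sq_sqrt h0.le

lemma injOn_sqrt_sub_div {u : ℝ} (hu : 0 < u) :
    InjOn (fun t : ℝ => √t - u / (2 * √t)) (Ioi 0) := by
  refine StrictMonoOn.injOn fun a ha b hb hab => ?_
  have ha : 0 < √a := Real.sqrt_pos.2 ha
  have h : √a < √b := Real.sqrt_lt_sqrt (Real.sqrt_pos.1 ha).le hab
  have : u / (2 * √b) < u / (2 * √a) := by gcongr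
  linarith

lemma hasDerivAt_sqrt_sub_div (u : ℝ) {t : ℝ} (ht : 0 < t) :
    HasDerivAt (fun t : ℝ => √t - u / (2 * √t)) (1 / (2 * √t) + u / (4 * (t * √t))) t := by
  have h := Real.hasDerivAt_sqrt ht.ne'
  have hs : 0 < √t := Real.sqrt_pos.2 ht
  have h2 := h.sub ((hasDerivAt_const t u).div (h.const_mul 2) (by positivity))
  refine h2.congr_deriv ?_
  have := Real.sq_sqrt ht.le
  field_simp
  rw [this]
  ring

/-- The bijection `y = √t - u/(2√t)` from the half line to the line satisfies `y² = t + u²/(4t) -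
u`, so it turns the Gaussian integral into `e^u` times a combination of the Bessel integrals of
index `1/2` and `-1/2`. -/
lemma besselInt_half {u : ℝ} (hu : 0 < u) :
    besselInt (1 / 2) u = √Real.pi * Real.exp (-u) := by
  have h1 : ∫ x : ℝ, Real.exp (-1 * x ^ 2) = √Real.pi := by simpa using integral_gaussian 1
  rw [← setIntegral_univ, ← image_sqrt_sub_div hu,
    integral_image_eq_integral_abs_deriv_smul measurableSet_Ioi
    (fun t ht => (hasDerivAt_sqrt_sub_div u ht).hasDerivWithinAt) (injOn_sqrt_sub_div hu)] at h1
  have h2 : ∀ t ∈ Ioi (0 : ℝ), |1 / (2 * √t) + u / (4 * (t * √t))| •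
      Real.exp (-1 * (√t - u / (2 * √t)) ^ 2) =
      Real.exp u * (1 / 2 * (t ^ ((1 / 2 : ℝ) - 1) * Real.exp (-t - u ^ 2 / (4 * t))) +
        u / 4 * (t ^ (-(1 / 2 : ℝ) - 1) * Real.exp (-t - u ^ 2 / (4 * t)))) := by
    intro t ht
    have ht : 0 < t := ht
    have hs : 0 < √t := Real.sqrt_pos.2 ht
    have e : -1 * (√t - u / (2 * √t)) ^ 2 = u + (-t - u ^ 2 / (4 * t)) := by
      have := Real.sq_sqrt ht.le
      rw [sub_sq, div_pow, mul_pow, this]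
      field_simp
      ring
    rw [abs_of_pos (by positivity), smul_eq_mul, e, Real.exp_add, Real.rpow_sub_one ht.ne',
      Real.rpow_sub_one ht.ne', Real.rpow_neg ht.le, ← Real.sqrt_eq_rpow]
    have : √t / t = 1 / √t := by
      rw [div_eq_div_iff ht.ne' hs.ne']
      linear_combination Real.sq_sqrt ht.le
    rw [this]
    field_simp
  rw [setIntegral_congr_fun measurableSet_Ioi h2, integral_const_mul, integral_add
    ((integrableOn_besselInt (by norm_num : (0 : ℝ) < 1 / 2) u).const_mul _)
    ((integrableOn_besselInt_neg (by norm_num : (0 : ℝ) < 1 / 2) hu).const_mul _),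
    integral_const_mul, integral_const_mul] at h1
  -- Reflection gives `besselInt (1/2) u = (u/2) besselInt (-1/2) u`, so the two terms of `h1` are
  -- equal and each contributes half.
  have h3 := besselInt_eq_neg (1 / 2) hu
  rw [← Real.sqrt_eq_rpow, show u ^ 2 / 4 = (u / 2) ^ 2 by ring,
    Real.sqrt_sq (by positivity)] at h3
  change Real.exp u * (1 / 2 * besselInt (1 / 2) u + u / 4 * besselInt (-(1 / 2)) u) = _ at h1
  rw [Real.exp_neg, ← h1]
  have := Real.exp_pos u
  field_simp
  linear_combination 4 * h3

/-! ### The generalized hyperbolic law -/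

lemma ghPDF_eq (l : ℝ) {α δ : ℝ} (hα : 0 < α) (hδ : 0 < δ) (x : ℝ) :
    ghPDF l α δ x = α / (2 * √Real.pi) *
      (besselInt (l - 1 / 2) (α * √(δ ^ 2 + x ^ 2)) / besselInt l (α * δ)) := by
  have hs : 0 < √(δ ^ 2 + x ^ 2) := Real.sqrt_pos.2 (by positivity)
  rw [ghPDF, Real.sqrt_sq hα.le, besselK_eq l (by positivity), besselK_eq _ (by positivity),
    mul_comm δ α]
  generalize √(δ ^ 2 + x ^ 2) = r at *
  generalize besselInt (l - 1 / 2) (α * r) = A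
  -- With a zero denominator both sides are zero by the division convention, so no positivity, and
  -- hence no condition on `l`, is required.
  rcases eq_or_ne (besselInt l (α * δ)) 0 with h0 | h0
  · simp [h0]
  generalize besselInt l (α * δ) = B at *
  rw [neg_sub, Real.div_rpow hα.le hδ.le, Real.rpow_neg (by positivity),
    Real.div_rpow (by positivity) zero_le_two, Real.mul_rpow hα.le hδ.le,
    Real.div_rpow hs.le hα.le, Real.div_rpow (by positivity) zero_le_two,
    Real.mul_rpow hα.le hs.le, Real.sqrt_mul zero_le_two]
  have e2 : ((2 : ℝ) ^ (1 / 2 - l)) * 2 ^ l = √2 := by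
    rw [← Real.rpow_add two_pos, sub_add_cancel, Real.sqrt_eq_rpow]
  have ea : (α ^ (1 / 2 - l)) * α ^ l = √α := by
    rw [← Real.rpow_add hα, sub_add_cancel, Real.sqrt_eq_rpow]
  have ea2 := Real.mul_self_sqrt hα.le
  have p1 := Real.rpow_pos_of_pos hα l
  have p2 := Real.rpow_pos_of_pos hδ l
  have p3 := Real.rpow_pos_of_pos two_pos l
  have p4 := Real.rpow_pos_of_pos two_pos (1 / 2 - l)
  have p5 := Real.rpow_pos_of_pos hα (1 / 2 - l)
  have p6 := Real.rpow_pos_of_pos hs (1 / 2 - l)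
  have p7 : 0 < √Real.pi := Real.sqrt_pos.2 Real.pi_pos
  have p8 : 0 < √(2 : ℝ) := Real.sqrt_pos.2 two_pos
  generalize (2 : ℝ) ^ (1 / 2 - l) = b at *
  generalize (2 : ℝ) ^ l = b' at *
  generalize α ^ (1 / 2 - l) = c at *
  generalize α ^ l = c' at *
  have ew := Real.sq_sqrt (zero_le_two : (0 : ℝ) ≤ 2)
  generalize √(2 : ℝ) = w at *
  generalize √α = v at *
  field_simp
  rw [← ea2, ← ea]
  linear_combination -(c * c') ^ 2 * A * w * e2 - (c * c') ^ 2 * A * ew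

lemma measurable_besselInt (s : ℝ) : Measurable (besselInt s) :=
  ((measurable_besselIntegrand s).stronglyMeasurable.integral_prod_right
    (ν := volume.restrict (Ioi (0 : ℝ)))).measurable

lemma lintegral_gaussian {b : ℝ} (hb : 0 < b) :
    ∫⁻ z : ℝ, ENNReal.ofReal (Real.exp (-b * z ^ 2)) = ENNReal.ofReal √(Real.pi / b) := by
  rw [← integral_gaussian, ofReal_integral_eq_lintegral_ofReal (integrable_exp_neg_mul_sq hb)
    (ae_of_all _ fun z => (Real.exp_pos _).le)]

/-- After Tonelli the inner integral is Gaussian in `z` with rate `α²/(4t)`; its value contributes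
`√t`, which raises the index by one half. -/
lemma lintegral_besselInt {s α : ℝ} (hs : 0 < s) (hα : 0 < α) (δ : ℝ) :
    ∫⁻ z : ℝ, ENNReal.ofReal (besselInt s (α * √(δ ^ 2 + z ^ 2))) =
      ENNReal.ofReal (2 * √Real.pi / α * besselInt (s + 1 / 2) (α * δ)) := by
  simp_rw [ofReal_besselInt hs]
  rw [lintegral_lintegral_swap (by fun_prop), ENNReal.ofReal_mul (by positivity),
    ofReal_besselInt (by linarith), ← lintegral_const_mul _ (by fun_prop)]
  refine setLIntegral_congr_fun measurableSet_Ioi fun t ht => ?_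
  have ht : 0 < t := ht
  have e : ∀ z : ℝ, ENNReal.ofReal (t ^ (s - 1) *
      Real.exp (-t - (α * √(δ ^ 2 + z ^ 2)) ^ 2 / (4 * t))) =
      ENNReal.ofReal (t ^ (s - 1) * Real.exp (-t - (α * δ) ^ 2 / (4 * t))) *
        ENNReal.ofReal (Real.exp (-(α ^ 2 / (4 * t)) * z ^ 2)) := by
    intro z
    rw [← ENNReal.ofReal_mul (by positivity), mul_assoc, ← Real.exp_add, mul_pow,
      Real.sq_sqrt (by positivity)]
    congr 3
    ring
  simp_rw [e]
  rw [lintegral_const_mul _ (by fun_prop), lintegral_gaussian (by positivity),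
    ← ENNReal.ofReal_mul (by positivity), ← ENNReal.ofReal_mul (by positivity)]
  congr 1
  have : √(Real.pi / (α ^ 2 / (4 * t))) = 2 * √Real.pi / α * √t := by
    rw [show Real.pi / (α ^ 2 / (4 * t)) = (2 / α) ^ 2 * (Real.pi * t) by field_simp; ring,
      Real.sqrt_mul (by positivity), Real.sqrt_sq (by positivity), Real.sqrt_mul Real.pi_pos.le]
    ring
  rw [this, show s + 1 / 2 - 1 = (s - 1) + 1 / 2 by ring, Real.rpow_add ht, ← Real.sqrt_eq_rpow]
  ring

lemma measurable_ghPDF (l : ℝ) {α δ : ℝ} (hα : 0 < α) (hδ : 0 < δ) :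
    Measurable (ghPDF l α δ) := by
  rw [funext (ghPDF_eq l hα hδ)]
  have := measurable_besselInt (l - 1 / 2)
  fun_prop

lemma ghPDF_nonneg {l α δ : ℝ} (hl : 1 / 2 < l) (hα : 0 < α) (hδ : 0 < δ) (x : ℝ) :
    0 ≤ ghPDF l α δ x := by
  rw [ghPDF_eq l hα hδ]
  have h1 := besselInt_pos (sub_pos.2 hl) (α * √(δ ^ 2 + x ^ 2))
  have h2 := besselInt_pos (by linarith : 0 < l) (α * δ)
  positivity

lemma lintegral_ghPDF {l α δ : ℝ} (hl : 1 / 2 < l) (hα : 0 < α) (hδ : 0 < δ) :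
    ∫⁻ x, ENNReal.ofReal (ghPDF l α δ x) = 1 := by
  have h2 := besselInt_pos (by linarith : 0 < l) (α * δ)
  have e : ∀ x, ENNReal.ofReal (ghPDF l α δ x) =
      ENNReal.ofReal (α / (2 * √Real.pi) / besselInt l (α * δ)) *
        ENNReal.ofReal (besselInt (l - 1 / 2) (α * √(δ ^ 2 + x ^ 2))) := by
    intro x
    rw [← ENNReal.ofReal_mul (by positivity), ghPDF_eq l hα hδ]
    congr 1
    ring
  have := measurable_besselInt (l - 1 / 2)
  simp_rw [e]
  rw [lintegral_const_mul _ (by fun_prop), lintegral_besselInt (sub_pos.2 hl) hα,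
    ← ENNReal.ofReal_mul (by positivity), sub_add_cancel, ← ENNReal.ofReal_one]
  congr 1
  have : 0 < √Real.pi := Real.sqrt_pos.2 Real.pi_pos
  field_simp

lemma isProbabilityMeasure_ghLaw {l α δ : ℝ} (hl : 1 / 2 < l) (hα : 0 < α) (hδ : 0 < δ) :
    IsProbabilityMeasure (ghLaw l α δ) :=
  ⟨by rw [ghLaw, withDensity_apply _ .univ, setLIntegral_univ, lintegral_ghPDF hl hα hδ]⟩

lemma ghLaw_apply {l α δ : ℝ} (hl : 1 / 2 < l) (hα : 0 < α) (hδ : 0 < δ) {C : Set ℝ}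
    (hC : MeasurableSet C) : ghLaw l α δ C = ENNReal.ofReal (ghF C l α δ) := by
  have hi : Integrable (ghPDF l α δ) := by
    refine ⟨(measurable_ghPDF l hα hδ).aestronglyMeasurable, ?_⟩
    rw [hasFiniteIntegral_iff_ofReal (ae_of_all _ (ghPDF_nonneg hl hα hδ)),
      lintegral_ghPDF hl hα hδ]
    exact ENNReal.one_lt_top
  rw [ghLaw, withDensity_apply _ hC, ghF, ofReal_integral_eq_lintegral_ofReal hi.integrableOn
    (ae_of_all _ (ghPDF_nonneg hl hα hδ))]

/-- The product of a `GH (3/2, ν, 1)` density and the `GH (1, ν, √(1 + x²))` density is the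
spherical bivariate hyperbolic density. -/
lemma ghPDF_mul_ghPDF {ν : ℝ} (hν : 0 < ν) (x z : ℝ) :
    ghPDF (3 / 2) ν 1 x * ghPDF 1 ν (√(1 + x ^ 2)) z =
      ν ^ 2 / (4 * √Real.pi * besselInt (3 / 2) ν) * Real.exp (-ν * √(1 + (x ^ 2 + z ^ 2))) := by
  have h0 : 0 < 1 + x ^ 2 := by positivity
  have hs : 0 < √(1 + x ^ 2) := Real.sqrt_pos.2 h0
  have hr : 0 < √(1 + x ^ 2 + z ^ 2) := Real.sqrt_pos.2 (by positivity)
  -- The numerator of the first density is the denominator of the second, and index `1 - 1/2` has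
  -- the exponential closed form.
  rw [ghPDF_eq _ hν one_pos, ghPDF_eq _ hν hs, Real.sq_sqrt h0.le,
    show (1 : ℝ) - 1 / 2 = 1 / 2 by norm_num, besselInt_half (by positivity),
    show (3 / 2 : ℝ) - 1 / 2 = 1 by norm_num, one_pow, mul_one, ← add_assoc, neg_mul]
  have h1 := besselInt_pos one_pos (ν * √(1 + x ^ 2))
  have h2 := besselInt_pos (by norm_num : (0 : ℝ) < 3 / 2) ν
  have p : 0 < √Real.pi := Real.sqrt_pos.2 Real.pi_pos
  field_simp
  ring

/-! ### Change of variables from the unit interval to the line -/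

lemma map_withDensity_comp {α β : Type*} [MeasurableSpace α] [MeasurableSpace β] (μ : Measure α)
    {g : α → β} (hg : Measurable g) {f : β → ENNReal} (hf : Measurable f) :
    (μ.withDensity fun a => f (g a)).map g = (μ.map g).withDensity f := by
  ext s hs
  rw [Measure.map_apply hg hs, withDensity_apply _ (hg hs), withDensity_apply _ hs,
    setLIntegral_map hs hf hg]

/-- The Jacobian of `tilde η σ`. -/
def tildeJac (σ w : ℝ) : ℝ := 1 / ((1 - w) * tOf w * σ)

lemma tOf_pos {w : ℝ} (hw : w ∈ Ioo (0 : ℝ) 1) : 0 < tOf w :=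
  neg_pos.2 (Real.log_neg (by linarith [hw.2]) (by linarith [hw.1]))

@[fun_prop]
lemma measurable_tOf : Measurable tOf := by
  unfold tOf
  fun_prop

@[fun_prop]
lemma measurable_tilde (η σ : ℝ) : Measurable (tilde η σ) := by
  unfold tilde stdLog
  fun_prop

@[fun_prop]
lemma measurable_tildeJac (σ : ℝ) : Measurable (tildeJac σ) := by
  unfold tildeJac
  fun_prop

lemma tildeJac_pos {σ w : ℝ} (hσ : 0 < σ) (hw : w ∈ Ioo (0 : ℝ) 1) : 0 < tildeJac σ w := by
  have := tOf_pos hw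
  have : 0 < 1 - w := by linarith [hw.2]
  unfold tildeJac
  positivity

lemma tilde_eq {η : ℝ} (hη : 0 < η) (σ : ℝ) {w : ℝ} (hw : w ∈ Ioo (0 : ℝ) 1) :
    tilde η σ w = 1 / σ * (Real.log (tOf w) - Real.log η) := by
  have := tOf_pos hw
  rw [tilde, stdLog, Real.log_rpow (by positivity), Real.log_div this.ne' hη.ne']

lemma hasDerivWithinAt_tilde {η : ℝ} (hη : 0 < η) (σ : ℝ) {w : ℝ} (hw : w ∈ Ioo (0 : ℝ) 1) :
    HasDerivWithinAt (tilde η σ) (tildeJac σ w) (Ioo 0 1) w := by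
  have h1 : 1 - w ≠ 0 := by linarith [hw.2]
  have h2 : HasDerivAt tOf (1 / (1 - w)) w :=
    (((hasDerivAt_id w).const_sub 1).log h1).neg.congr_deriv (by simp [neg_div])
  have h3 := ((h2.log (tOf_pos hw).ne').sub_const (Real.log η)).const_mul (1 / σ)
  refine (h3.congr_deriv ?_).hasDerivWithinAt.congr (fun x hx => tilde_eq hη σ hx)
    (tilde_eq hη σ hw)
  rw [tildeJac, div_div, one_div_mul_one_div, mul_comm σ]

lemma injOn_tilde {η σ : ℝ} (hη : 0 < η) (hσ : 0 < σ) : InjOn (tilde η σ) (Ioo 0 1) := by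
  intro a ha b hb h
  rw [tilde_eq hη σ ha, tilde_eq hη σ hb] at h
  have h1 := sub_left_injective (mul_left_cancel₀ (one_div_pos.2 hσ).ne' h)
  have h2 := neg_injective (Real.log_injOn_pos (tOf_pos ha) (tOf_pos hb) h1)
  have h3 := Real.log_injOn_pos (by simpa using ha.2) (by simpa using hb.2) h2
  linarith

lemma image_tilde {η σ : ℝ} (hη : 0 < η) (hσ : 0 < σ) : tilde η σ '' Ioo 0 1 = univ := by
  -- The witness inverts the transformation: `t = η e^(σy)` and `w = 1 - e^(-t)`.
  refine eq_univ_of_forall fun y => ⟨1 - Real.exp (-(η * Real.exp (σ * y))), ⟨?_, ?_⟩, ?_⟩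
  · rw [sub_pos, Real.exp_lt_one_iff]
    have := Real.exp_pos (σ * y)
    exact neg_neg_of_pos (by positivity)
  · have := Real.exp_pos (-(η * Real.exp (σ * y)))
    linarith
  · rw [tilde, stdLog, tOf, sub_sub_cancel, Real.log_exp, neg_neg, mul_div_cancel_left₀ _ hη.ne',
      Real.log_rpow (Real.exp_pos _), Real.log_exp]
    field_simp

lemma measurableSet_image_tilde {η σ : ℝ} (hη : 0 < η) (hσ : 0 < σ) {B : Set ℝ}
    (hB : MeasurableSet B) (hB1 : B ⊆ Ioo 0 1) : MeasurableSet (tilde η σ '' B) :=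
  hB.image_of_measurable_injOn (measurable_tilde η σ) ((injOn_tilde hη hσ).mono hB1)

lemma setLIntegral_image_tilde {η σ : ℝ} (hη : 0 < η) (hσ : 0 < σ) {B : Set ℝ}
    (hB : MeasurableSet B) (hB1 : B ⊆ Ioo 0 1) (g : ℝ → ENNReal) :
    ∫⁻ y in tilde η σ '' B, g y =
      ∫⁻ w in B, ENNReal.ofReal (tildeJac σ w) * g (tilde η σ w) := by
  rw [lintegral_image_eq_lintegral_abs_deriv_mul hB
    (fun w hw => (hasDerivWithinAt_tilde hη σ (hB1 hw)).mono hB1)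
    ((injOn_tilde hη hσ).mono hB1)]
  refine setLIntegral_congr_fun hB fun w hw => ?_
  rw [abs_of_pos (tildeJac_pos hσ (hB1 hw))]

/-- The measure on the unit interval which `tilde η σ` maps to Lebesgue measure. -/
def unitMeasure (σ : ℝ) : Measure ℝ :=
  (volume.restrict (Ioo (0 : ℝ) 1)).withDensity fun w => ENNReal.ofReal (tildeJac σ w)

instance (σ : ℝ) : SFinite (unitMeasure σ) := by
  unfold unitMeasure
  infer_instance

lemma setLIntegral_unitMeasure (σ : ℝ) {B : Set ℝ} (hB : MeasurableSet B) {g : ℝ → ENNReal}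
    (hg : Measurable g) : ∫⁻ w in B, g w ∂unitMeasure σ =
      ∫⁻ w in B ∩ Ioo 0 1, ENNReal.ofReal (tildeJac σ w) * g w := by
  rw [unitMeasure, setLIntegral_withDensity_eq_setLIntegral_mul _ (by fun_prop) hg hB,
    Measure.restrict_restrict hB]
  rfl

lemma map_tilde_unitMeasure {η σ : ℝ} (hη : 0 < η) (hσ : 0 < σ) :
    (unitMeasure σ).map (tilde η σ) = volume := by
  refine Measure.ext_of_lintegral _ fun f hf => ?_
  rw [lintegral_map hf (by fun_prop), ← setLIntegral_univ,
    setLIntegral_unitMeasure σ .univ (by fun_prop), univ_inter,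
    ← setLIntegral_image_tilde hη hσ measurableSet_Ioo subset_rfl f, image_tilde hη hσ,
    setLIntegral_univ]

lemma map_tilde_prod_unitMeasure (θ : Param) :
    ((unitMeasure θ.σ₁).prod (unitMeasure θ.σ₂)).map
      (Prod.map (tilde θ.η₁ θ.σ₁) (tilde θ.η₂ θ.σ₂)) = volume := by
  rw [← Measure.map_prod_map _ _ (by fun_prop) (by fun_prop),
    map_tilde_unitMeasure θ.η₁_pos θ.σ₁_pos, map_tilde_unitMeasure θ.η₂_pos θ.σ₂_pos,
    ← Measure.volume_eq_prod]

/-! ### The conditional standardization -/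

lemma setLIntegral_image_affine {s : ℝ} (hs : 0 < s) (c : ℝ) {T : Set ℝ} (hT : MeasurableSet T)
    (g : ℝ → ENNReal) : ∫⁻ z in (fun y => (y - c) / s) '' T, g z =
      ∫⁻ y in T, ENNReal.ofReal (1 / s) * g ((y - c) / s) := by
  have hd : ∀ y ∈ T, HasDerivWithinAt (fun y => (y - c) / s) (1 / s) T y := fun y _ =>
    (((hasDerivAt_id y).sub_const c).div_const s).hasDerivWithinAt
  rw [lintegral_image_eq_lintegral_abs_deriv_mul hT hd
    (fun a _ b _ h => by simpa [hs.ne'] using h), abs_of_pos (by positivity)]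

lemma lintegral_comp_affine {s : ℝ} (hs : 0 < s) (c : ℝ) (g : ℝ → ENNReal) :
    ∫⁻ z, g z = ∫⁻ y, ENNReal.ofReal (1 / s) * g ((y - c) / s) := by
  rw [← setLIntegral_univ, ← setLIntegral_univ (fun y => _ * _),
    ← setLIntegral_image_affine hs c .univ, image_univ_of_surjective]
  exact fun z => ⟨s * z + c, by field_simp; ring⟩

lemma one_sub_sq_pos {ρ : ℝ} (hρ : ρ ∈ Ioo (-1 : ℝ) 1) : 0 < 1 - ρ ^ 2 := by
  nlinarith [hρ.1, hρ.2]

lemma quadForm_eq {ρ : ℝ} (hρ : ρ ∈ Ioo (-1 : ℝ) 1) (x y : ℝ) :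
    quadForm ρ x y = x ^ 2 + ((y - ρ * x) / √(1 - ρ ^ 2)) ^ 2 := by
  have h := one_sub_sq_pos hρ
  rw [quadForm, div_pow, Real.sq_sqrt h.le]
  field_simp
  ring

lemma quadForm_comm (ρ x y : ℝ) : quadForm ρ x y = quadForm ρ y x := by
  unfold quadForm
  ring

/-- The joint density `f(x) h((y - ρx)/√(1-ρ²) ∣ x) / √(1-ρ²)` of the standardized logarithms. -/
def hypDensity (ν ρ : ℝ) (p : ℝ × ℝ) : ENNReal :=
  ENNReal.ofReal (ghPDF (3 / 2) ν 1 p.1) * (ENNReal.ofReal (1 / √(1 - ρ ^ 2)) *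
    ENNReal.ofReal (ghPDF 1 ν (√(1 + p.1 ^ 2)) ((p.2 - ρ * p.1) / √(1 - ρ ^ 2))))

lemma sqrt_one_add_sq_pos (x : ℝ) : 0 < √(1 + x ^ 2) := Real.sqrt_pos.2 (by positivity)

lemma measurable_ghPDF_uncurry {ν : ℝ} (hν : 0 < ν) :
    Measurable fun p : ℝ × ℝ => ghPDF 1 ν (√(1 + p.1 ^ 2)) p.2 := by
  simp_rw [ghPDF_eq 1 hν (sqrt_one_add_sq_pos _)]
  have h1 := measurable_besselInt (1 - 1 / 2)
  have h2 := measurable_besselInt 1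
  fun_prop

lemma measurable_hypDensity {ν : ℝ} (hν : 0 < ν) (ρ : ℝ) : Measurable (hypDensity ν ρ) := by
  have h1 := measurable_ghPDF (3 / 2) hν one_pos
  have h2 := (measurable_ghPDF_uncurry hν).comp
    (by fun_prop : Measurable fun p : ℝ × ℝ => (p.1, (p.2 - ρ * p.1) / √(1 - ρ ^ 2)))
  exact (h1.comp measurable_fst).ennreal_ofReal.mul (h2.ennreal_ofReal.const_mul _)

/-- For fixed `x`, the affine substitution reduces the integral in `y` to the total mass of the
conditional law; the marginal density is left. -/
lemma lintegral_hypDensity {ν ρ : ℝ} (hν : 0 < ν) (hρ : ρ ∈ Ioo (-1 : ℝ) 1) :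
    ∫⁻ p, hypDensity ν ρ p = 1 := by
  have hs := Real.sqrt_pos.2 (one_sub_sq_pos hρ)
  rw [Measure.volume_eq_prod, lintegral_prod _ (measurable_hypDensity hν ρ).aemeasurable]
  simp_rw [hypDensity]
  have : ∀ x, ∫⁻ y, ENNReal.ofReal (ghPDF (3 / 2) ν 1 x) * (ENNReal.ofReal (1 / √(1 - ρ ^ 2)) *
      ENNReal.ofReal (ghPDF 1 ν (√(1 + x ^ 2)) ((y - ρ * x) / √(1 - ρ ^ 2)))) =
      ENNReal.ofReal (ghPDF (3 / 2) ν 1 x) := by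
    intro x
    rw [lintegral_const_mul' _ _ ENNReal.ofReal_ne_top, ← lintegral_comp_affine hs (ρ * x)
      (fun z => ENNReal.ofReal (ghPDF 1 ν (√(1 + x ^ 2)) z)),
      lintegral_ghPDF (by norm_num) hν (sqrt_one_add_sq_pos x), mul_one]
  simp_rw [this]
  exact lintegral_ghPDF (by norm_num) hν one_pos

/-- A probability density proportional to `hypGen ν (quadForm ρ x y)` is `hypDensity ν ρ`. -/
lemma ofReal_hypGen_eq {ν ρ : ℝ} (hν : 0 < ν) (hρ : ρ ∈ Ioo (-1 : ℝ) 1) (C : ℝ)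
    (h : ∫⁻ p : ℝ × ℝ, ENNReal.ofReal (C * hypGen ν (quadForm ρ p.1 p.2)) = 1) :
    (fun p : ℝ × ℝ => ENNReal.ofReal (C * hypGen ν (quadForm ρ p.1 p.2))) = hypDensity ν ρ := by
  have hs := Real.sqrt_pos.2 (one_sub_sq_pos hρ)
  have hI := besselInt_pos (by norm_num : (0 : ℝ) < 3 / 2) ν
  have hk : 0 < ν ^ 2 / (4 * √Real.pi * besselInt (3 / 2) ν) / √(1 - ρ ^ 2) := by
    have := Real.sqrt_pos.2 Real.pi_pos
    positivity
  -- The divisor of `C` is the normalizing constant of `hypDensity`. Integrating this identity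
  -- forces the prefactor to be one.
  have key : ∀ p : ℝ × ℝ, ENNReal.ofReal (C * hypGen ν (quadForm ρ p.1 p.2)) =
      ENNReal.ofReal (C / (ν ^ 2 / (4 * √Real.pi * besselInt (3 / 2) ν) / √(1 - ρ ^ 2))) *
        hypDensity ν ρ p := by
    intro p
    rw [hypDensity, mul_left_comm (ENNReal.ofReal (ghPDF _ _ _ _)), ← ENNReal.ofReal_mul
      (ghPDF_nonneg (by norm_num) hν one_pos _), ghPDF_mul_ghPDF hν, ← quadForm_eq hρ,
      ← ENNReal.ofReal_mul (by positivity), ← ENNReal.ofReal_mul' (by positivity), ← hypGen]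
    congr 1
    have := Real.sqrt_pos.2 Real.pi_pos
    field_simp
  simp_rw [key] at h
  rw [lintegral_const_mul _ (measurable_hypDensity hν ρ), lintegral_hypDensity hν hρ, mul_one] at h
  funext p
  rw [key, h, one_mul]

/-- The conditional law `x ↦ GH (1, ν, √(1 + x²))` as a kernel. -/
def ghKernel (ν : ℝ) : Kernel ℝ ℝ :=
  (Kernel.const ℝ volume).withDensity fun x z => ENNReal.ofReal (ghPDF 1 ν (√(1 + x ^ 2)) z)

lemma ghKernel_apply {ν : ℝ} (hν : 0 < ν) (x : ℝ) :
    ghKernel ν x = ghLaw 1 ν (√(1 + x ^ 2)) := by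
  rw [ghKernel, Kernel.withDensity_apply _ (measurable_ghPDF_uncurry hν).ennreal_ofReal]
  rfl

lemma isMarkovKernel_ghKernel {ν : ℝ} (hν : 0 < ν) : IsMarkovKernel (ghKernel ν) :=
  ⟨fun x => ghKernel_apply hν x ▸
    isProbabilityMeasure_ghLaw (by norm_num) hν (sqrt_one_add_sq_pos x)⟩

/-- Tested against a nonnegative measurable function, both sides are iterated integrals, and for
each fixed `x` the inner ones agree by the affine substitution. -/
lemma map_standardize {Ω : Type*} [MeasurableSpace Ω] {P : Measure Ω} {X Y : Ω → ℝ}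
    (hX : Measurable X) (hY : Measurable Y) {ν ρ : ℝ} (hν : 0 < ν) (hρ : ρ ∈ Ioo (-1 : ℝ) 1)
    (h : P.map (fun ω => (X ω, Y ω)) = volume.withDensity (hypDensity ν ρ)) :
    P.map (fun ω => (X ω, (Y ω - ρ * X ω) / √(1 - ρ ^ 2))) =
      ghLaw (3 / 2) ν 1 ⊗ₘ ghKernel ν := by
  have := isMarkovKernel_ghKernel hν
  have := isProbabilityMeasure_ghLaw (by norm_num : (1 : ℝ) / 2 < 3 / 2) hν one_pos
  have hs := Real.sqrt_pos.2 (one_sub_sq_pos hρ)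
  have hm1 := (measurable_ghPDF (3 / 2) hν one_pos).ennreal_ofReal
  have hd := measurable_hypDensity hν ρ
  refine Measure.ext_of_lintegral _ fun f hf => ?_
  have hA : Measurable fun p : ℝ × ℝ => (p.1, (p.2 - ρ * p.1) / √(1 - ρ ^ 2)) := by fun_prop
  have e : P.map (fun ω => (X ω, (Y ω - ρ * X ω) / √(1 - ρ ^ 2))) =
      (P.map fun ω => (X ω, Y ω)).map fun p : ℝ × ℝ => (p.1, (p.2 - ρ * p.1) / √(1 - ρ ^ 2)) := by
    rw [Measure.map_map hA (by fun_prop)]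
    rfl
  rw [e, lintegral_map hf hA]
  have hfA : Measurable fun p : ℝ × ℝ => f (p.1, (p.2 - ρ * p.1) / √(1 - ρ ^ 2)) := hf.comp hA
  rw [h, lintegral_withDensity_eq_lintegral_mul _ hd hfA, Measure.volume_eq_prod,
    lintegral_prod _ (hd.mul hfA).aemeasurable, Measure.lintegral_compProd hf]
  have hk : Measurable fun x => ∫⁻ z, f (x, z) ∂ghKernel ν x := hf.lintegral_kernel_prod_right'
  rw [ghLaw, lintegral_withDensity_eq_lintegral_mul _ hm1 hk]
  refine lintegral_congr fun x => ?_
  have hm3 := (measurable_ghPDF 1 hν (sqrt_one_add_sq_pos x)).ennreal_ofReal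
  have hfx : Measurable fun z => f (x, z) := by fun_prop
  simp only [Pi.mul_apply]
  rw [ghKernel_apply hν, ghLaw, lintegral_withDensity_eq_lintegral_mul _ hm3 hfx]
  simp only [Pi.mul_apply]
  rw [lintegral_comp_affine hs (ρ * x)
    fun z => ENNReal.ofReal (ghPDF 1 ν (√(1 + x ^ 2)) z) * f (x, z),
    ← lintegral_const_mul' _ _ ENNReal.ofReal_ne_top]
  refine lintegral_congr fun y => ?_
  simp only [hypDensity]
  ring

lemma map_fst_eq_ghLaw {Ω : Type*} [MeasurableSpace Ω] {P : Measure Ω} {X Y : Ω → ℝ}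
    (hX : Measurable X) (hY : Measurable Y) {ν ρ : ℝ} (hν : 0 < ν) (hρ : ρ ∈ Ioo (-1 : ℝ) 1)
    (h : P.map (fun ω => (X ω, Y ω)) = volume.withDensity (hypDensity ν ρ)) :
    P.map X = ghLaw (3 / 2) ν 1 := by
  have := isMarkovKernel_ghKernel hν
  have := isProbabilityMeasure_ghLaw (by norm_num : (1 : ℝ) / 2 < 3 / 2) hν one_pos
  have e := congrArg Measure.fst (map_standardize hX hY hν hρ h)
  rwa [Measure.fst_compProd, Measure.fst_map_prodMk (by fun_prop)] at e

/-- Almost everywhere uniqueness of the disintegration: the joint law is already the first marginal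
composed with `ghKernel`. -/
lemma condDistrib_standardize {Ω : Type*} [MeasurableSpace Ω] {P : Measure Ω}
    [IsProbabilityMeasure P] {X Y : Ω → ℝ}
    (hX : Measurable X) (hY : Measurable Y) {ν ρ : ℝ} (hν : 0 < ν) (hρ : ρ ∈ Ioo (-1 : ℝ) 1)
    (h : P.map (fun ω => (X ω, Y ω)) = volume.withDensity (hypDensity ν ρ)) :
    ∀ᵐ x ∂P.map X, condDistrib (fun ω => (Y ω - ρ * X ω) / √(1 - ρ ^ 2)) X P x =
      ghLaw 1 ν (√(1 + x ^ 2)) := by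
  have := isMarkovKernel_ghKernel hν
  have e := condDistrib_ae_eq_of_measure_eq_compProd X (μ := P)
    (Y := fun ω => (Y ω - ρ * X ω) / √(1 - ρ ^ 2)) (κ := ghKernel ν) (by fun_prop)
    (by rw [map_standardize hX hY hν hρ h, map_fst_eq_ghLaw hX hY hν hρ h])
  filter_upwards [e] with x hx
  rw [hx, ghKernel_apply hν]

/-! ### The joint laws -/

lemma measurable_hypGen_quadForm (ν ρ C : ℝ) :
    Measurable fun p : ℝ × ℝ => ENNReal.ofReal (C * hypGen ν (quadForm ρ p.1 p.2)) := by
  unfold hypGen quadForm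
  fun_prop

/-- The Jacobian factors and the indicator are absorbed into the reference measure. What remains
depends on `w` only through the standardized logarithms. -/
lemma withDensity_jointPDF (θ : Param) {g : ℝ → ℝ} (hg : Measurable g) :
    volume.withDensity (fun w => ENNReal.ofReal (jointPDF θ g w)) =
      ((unitMeasure θ.σ₁).prod (unitMeasure θ.σ₂)).withDensity fun w =>
        ENNReal.ofReal (1 / (√(1 - θ.ρ ^ 2) * partitionFn θ g) *
          g (quadForm θ.ρ (tilde θ.η₁ θ.σ₁ w.1) (tilde θ.η₂ θ.σ₂ w.2))) := by
  have hq : Measurable fun w : ℝ × ℝ => ENNReal.ofReal (1 / (√(1 - θ.ρ ^ 2) * partitionFn θ g) *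
      g (quadForm θ.ρ (tilde θ.η₁ θ.σ₁ w.1) (tilde θ.η₂ θ.σ₂ w.2))) := by
    unfold quadForm
    fun_prop
  rw [unitMeasure, unitMeasure, prod_withDensity (by fun_prop) (by fun_prop),
    Measure.prod_restrict, ← Measure.volume_eq_prod,
    ← withDensity_mul _ (by fun_prop) hq, ← withDensity_indicator
      (measurableSet_Ioo.prod measurableSet_Ioo)]
  congr 1
  funext w
  by_cases hw : w ∈ Ioo (0 : ℝ) 1 ×ˢ Ioo (0 : ℝ) 1
  · rw [jointPDF, indicator_of_mem hw, indicator_of_mem hw, Pi.mul_apply,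
      ← ENNReal.ofReal_mul (tildeJac_pos θ.σ₁_pos hw.1).le, ← ENNReal.ofReal_mul
        (mul_pos (tildeJac_pos θ.σ₁_pos hw.1) (tildeJac_pos θ.σ₂_pos hw.2)).le]
    congr 1
    simp only [tildeJac, one_div, mul_inv]
    ring
  · rw [jointPDF, indicator_of_notMem hw, indicator_of_notMem hw, ENNReal.ofReal_zero]

/-- The law of `(W₁, W₂)` for the hyperbolic generator, relative to `unitMeasure`. -/
lemma IsBULS.map_eq {Ω : Type*} [MeasurableSpace Ω] {P : Measure Ω} [IsProbabilityMeasure P]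
    {W₁ W₂ : Ω → ℝ} (hW₁ : Measurable W₁) (hW₂ : Measurable W₂) {θ : Param} {ν : ℝ} (hν : 0 < ν)
    (hW : IsBULS P W₁ W₂ θ (hypGen ν)) :
    P.map (fun ω => (W₁ ω, W₂ ω)) =
      ((unitMeasure θ.σ₁).prod (unitMeasure θ.σ₂)).withDensity fun w =>
        hypDensity ν θ.ρ (tilde θ.η₁ θ.σ₁ w.1, tilde θ.η₂ θ.σ₂ w.2) := by
  have hg : Measurable (hypGen ν) := by
    unfold hypGen
    fun_prop
  set C := 1 / (√(1 - θ.ρ ^ 2) * partitionFn θ (hypGen ν)) with hC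
  have hm := measurable_hypGen_quadForm ν θ.ρ C
  have h1 := hW.trans (withDensity_jointPDF θ hg)
  rw [← hC] at h1
  have hT : Measurable (Prod.map (tilde θ.η₁ θ.σ₁) (tilde θ.η₂ θ.σ₂)) := by fun_prop
  -- Total mass one, transported to the plane. This is the only information used about the value of
  -- `partitionFn`.
  have hP : ∫⁻ p : ℝ × ℝ, ENNReal.ofReal (C * hypGen ν (quadForm θ.ρ p.1 p.2)) = 1 := by
    have hu : P.map (fun ω => (W₁ ω, W₂ ω)) univ = 1 := by
      rw [Measure.map_apply (by fun_prop) .univ, preimage_univ, measure_univ]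
    rw [← map_tilde_prod_unitMeasure θ, lintegral_map hm hT, ← hu, h1, withDensity_apply _ .univ, setLIntegral_univ]
    rfl
  rw [h1, ← ofReal_hypGen_eq hν θ.ρ_mem C hP]

lemma IsBULS.map_tilde {Ω : Type*} [MeasurableSpace Ω] {P : Measure Ω} [IsProbabilityMeasure P]
    {W₁ W₂ : Ω → ℝ} (hW₁ : Measurable W₁) (hW₂ : Measurable W₂) {θ : Param} {ν : ℝ} (hν : 0 < ν)
    (hW : IsBULS P W₁ W₂ θ (hypGen ν)) :
    P.map (fun ω => (tilde θ.η₁ θ.σ₁ (W₁ ω), tilde θ.η₂ θ.σ₂ (W₂ ω))) =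
      volume.withDensity (hypDensity ν θ.ρ) := by
  have hT : Measurable (Prod.map (tilde θ.η₁ θ.σ₁) (tilde θ.η₂ θ.σ₂)) := by fun_prop
  have h2 := congrArg (Measure.map (Prod.map (tilde θ.η₁ θ.σ₁) (tilde θ.η₂ θ.σ₂)))
    (hW.map_eq hW₁ hW₂ hν)
  rw [Measure.map_map hT (by fun_prop)] at h2
  refine h2.trans ?_
  refine (map_withDensity_comp _ hT (measurable_hypDensity hν θ.ρ)).trans ?_
  rw [map_tilde_prod_unitMeasure]

/-- The factorized form hides the symmetry; it appears once the product is rewritten through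
`quadForm`. -/
lemma hypDensity_swap {ν ρ : ℝ} (hν : 0 < ν) (hρ : ρ ∈ Ioo (-1 : ℝ) 1) (p : ℝ × ℝ) :
    hypDensity ν ρ p.swap = hypDensity ν ρ p := by
  have hs := Real.sqrt_pos.2 (one_sub_sq_pos hρ)
  have key : ∀ p : ℝ × ℝ, hypDensity ν ρ p = ENNReal.ofReal (1 / √(1 - ρ ^ 2)) *
      ENNReal.ofReal (ν ^ 2 / (4 * √Real.pi * besselInt (3 / 2) ν) *
        hypGen ν (quadForm ρ p.1 p.2)) := by
    intro p
    rw [hypDensity, mul_left_comm, ← ENNReal.ofReal_mul (ghPDF_nonneg (by norm_num) hν one_pos _),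
      ghPDF_mul_ghPDF hν, ← quadForm_eq hρ, ← hypGen]
  rw [key, key, Prod.fst_swap, Prod.snd_swap, quadForm_comm]

lemma map_swap_eq {Ω : Type*} [MeasurableSpace Ω] {P : Measure Ω} {X Y : Ω → ℝ}
    (hX : Measurable X) (hY : Measurable Y) {ν ρ : ℝ} (hν : 0 < ν) (hρ : ρ ∈ Ioo (-1 : ℝ) 1)
    (h : P.map (fun ω => (X ω, Y ω)) = volume.withDensity (hypDensity ν ρ)) :
    P.map (fun ω => (Y ω, X ω)) = volume.withDensity (hypDensity ν ρ) := by
  have h2 := congrArg (Measure.map Prod.swap) h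
  rw [Measure.map_map measurable_swap (by fun_prop)] at h2
  refine h2.trans ?_
  conv_lhs => rw [← funext (hypDensity_swap hν hρ)]
  rw [map_withDensity_comp _ measurable_swap (measurable_hypDensity hν ρ),
    Measure.volume_eq_prod, Measure.prod_swap]

/-! ### Conditioning on `W₂ ∈ B` -/

lemma transSet_eq (θ : Param) (r x : ℝ) (B : Set ℝ) :
    transSet θ r x B = (fun y => (y - r * x) / √(1 - r ^ 2)) '' (tilde θ.η₂ θ.σ₂ '' B) := by
  rw [transSet, image_image]
  congr 1
  funext w
  ring

lemma measurableSet_transSet (θ : Param) {r : ℝ} (hr : r ∈ Ioo (-1 : ℝ) 1) (x : ℝ) {B : Set ℝ}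
    (hB : MeasurableSet B) (hB1 : B ⊆ Ioo 0 1) : MeasurableSet (transSet θ r x B) := by
  have hs := Real.sqrt_pos.2 (one_sub_sq_pos hr)
  rw [transSet_eq]
  refine (measurableSet_image_tilde θ.η₂_pos θ.σ₂_pos hB hB1).image_of_measurable_injOn
    (by fun_prop) fun a _ b _ h => ?_
  simpa [hs.ne'] using h

/-- `tilde` carries `B` to its image and the affine map carries that image to `transSet`, the two
Jacobians being exactly those in the integrand. -/
lemma setLIntegral_hypDensity {θ : Param} {ν : ℝ} (hν : 0 < ν) (x : ℝ) {B : Set ℝ}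
    (hB : MeasurableSet B) (hB1 : B ⊆ Ioo 0 1) :
    ∫⁻ w in B, hypDensity ν θ.ρ (x, tilde θ.η₂ θ.σ₂ w) ∂unitMeasure θ.σ₂ =
      ENNReal.ofReal (ghPDF (3 / 2) ν 1 x) *
        ENNReal.ofReal (ghF (transSet θ θ.ρ x B) 1 ν (√(1 + x ^ 2))) := by
  have hs := Real.sqrt_pos.2 (one_sub_sq_pos θ.ρ_mem)
  have hm := measurable_hypDensity hν θ.ρ
  have hT := measurableSet_transSet θ θ.ρ_mem x hB hB1
  rw [setLIntegral_unitMeasure _ hB (by fun_prop), inter_eq_left.2 hB1,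
    ← setLIntegral_image_tilde θ.η₂_pos θ.σ₂_pos hB hB1 fun y => hypDensity ν θ.ρ (x, y)]
  simp only [hypDensity]
  rw [lintegral_const_mul' _ _ ENNReal.ofReal_ne_top, ← ghLaw_apply (by norm_num) hν
    (sqrt_one_add_sq_pos x) hT, ghLaw, withDensity_apply _ hT, transSet_eq,
    setLIntegral_image_affine hs _ (measurableSet_image_tilde θ.η₂_pos θ.σ₂_pos hB hB1)]

lemma IsBULS.measure_inter {Ω : Type*} [MeasurableSpace Ω] {P : Measure Ω}
    [IsProbabilityMeasure P] {W₁ W₂ : Ω → ℝ} (hW₁ : Measurable W₁) (hW₂ : Measurable W₂)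
    {θ : Param} {ν : ℝ} (hν : 0 < ν) (hW : IsBULS P W₁ W₂ θ (hypGen ν)) {S B : Set ℝ}
    (hS : MeasurableSet S) (hB : MeasurableSet B) (hB1 : B ⊆ Ioo 0 1) :
    P (W₂ ⁻¹' B ∩ W₁ ⁻¹' S) = ∫⁻ w in S ∩ Ioo 0 1, ENNReal.ofReal (tildeJac θ.σ₁ w) *
      (ENNReal.ofReal (ghPDF (3 / 2) ν 1 (tilde θ.η₁ θ.σ₁ w)) *
        ENNReal.ofReal (ghF (transSet θ θ.ρ (tilde θ.η₁ θ.σ₁ w) B) 1 ν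
          (√(1 + tilde θ.η₁ θ.σ₁ w ^ 2)))) := by
  have hm := measurable_hypDensity hν θ.ρ
  have hm2 : Measurable fun w : ℝ × ℝ =>
    hypDensity ν θ.ρ (tilde θ.η₁ θ.σ₁ w.1, tilde θ.η₂ θ.σ₂ w.2) := by fun_prop
  have e : W₂ ⁻¹' B ∩ W₁ ⁻¹' S = (fun ω => (W₁ ω, W₂ ω)) ⁻¹' S ×ˢ B := by
    ext ω
    simp [and_comm]
  rw [e, ← Measure.map_apply (by fun_prop) (hS.prod hB), hW.map_eq hW₁ hW₂ hν,
    withDensity_apply _ (hS.prod hB), setLIntegral_prod _ hm2.aemeasurable,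
    setLIntegral_unitMeasure _ hS hm2.lintegral_prod_right']
  simp_rw [setLIntegral_hypDensity hν _ hB hB1]

/-- With `r = 0` the set does not depend on `x`, so any `x` serves and the claim is the second
marginal law. -/
lemma IsBULS.measure_preimage {Ω : Type*} [MeasurableSpace Ω] {P : Measure Ω}
    [IsProbabilityMeasure P] {W₁ W₂ : Ω → ℝ} (hW₁ : Measurable W₁) (hW₂ : Measurable W₂)
    {θ : Param} {ν : ℝ} (hν : 0 < ν) (hW : IsBULS P W₁ W₂ θ (hypGen ν)) (x : ℝ) {B : Set ℝ}
    (hB : MeasurableSet B) (hB1 : B ⊆ Ioo 0 1) :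
    P (W₂ ⁻¹' B) = ENNReal.ofReal (ghF (transSet θ 0 x B) (3 / 2) ν 1) := by
  have hT := measurableSet_image_tilde θ.η₂_pos θ.σ₂_pos hB hB1
  have e : transSet θ 0 x B = tilde θ.η₂ θ.σ₂ '' B := by simp [transSet_eq]
  rw [e, ← ghLaw_apply (by norm_num) hν one_pos hT,
    ← map_fst_eq_ghLaw (by fun_prop) (by fun_prop) hν θ.ρ_mem
      (map_swap_eq (by fun_prop) (by fun_prop) hν θ.ρ_mem (hW.map_tilde hW₁ hW₂ hν)),
    Measure.map_apply (by fun_prop) hT]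
  -- `tilde` is known to be injective only on the unit interval, so the events `W₂ ∈ B` and `tilde
  -- W₂ ∈ tilde '' B` are compared almost surely.
  have hae : ∀ᵐ ω ∂P, W₂ ω ∈ Ioo (0 : ℝ) 1 := by
    have hS : MeasurableSet (Ioo (0 : ℝ) 1 ×ˢ Ioo (0 : ℝ) 1) :=
      measurableSet_Ioo.prod measurableSet_Ioo
    have h1 : ∀ᵐ p ∂P.map (fun ω => (W₁ ω, W₂ ω)), p ∈ Ioo (0 : ℝ) 1 ×ˢ Ioo (0 : ℝ) 1 := by
      rw [ae_iff]
      change P.map (fun ω => (W₁ ω, W₂ ω)) (Ioo (0 : ℝ) 1 ×ˢ Ioo (0 : ℝ) 1)ᶜ = 0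
      rw [hW, withDensity_apply _ hS.compl]
      refine (setLIntegral_congr_fun hS.compl fun p hp => ?_).trans lintegral_zero
      rw [jointPDF, indicator_of_notMem hp, ENNReal.ofReal_zero]
    exact (ae_of_ae_map (by fun_prop) h1).mono fun ω h => h.2
  refine measure_congr ?_
  filter_upwards [hae] with ω hω
  exact propext ((injOn_tilde θ.η₂_pos θ.σ₂_pos).mem_image_iff hB1 hω).symm

lemma IsBULS.map_cond {Ω : Type*} [MeasurableSpace Ω] {P : Measure Ω}
    [IsProbabilityMeasure P] {W₁ W₂ : Ω → ℝ} (hW₁ : Measurable W₁) (hW₂ : Measurable W₂)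
    {θ : Param} {ν : ℝ} (hν : 0 < ν) (hW : IsBULS P W₁ W₂ θ (hypGen ν)) {B : Set ℝ}
    (hB : MeasurableSet B) (hB1 : B ⊆ Ioo 0 1) (h0 : P (W₂ ⁻¹' B) ≠ 0) :
    (ProbabilityTheory.cond P (W₂ ⁻¹' B)).map W₁ =
      volume.withDensity fun w => ENNReal.ofReal (hypCondPDF θ ν B w) := by
  ext S hS
  rw [Measure.map_apply hW₁ hS, cond_apply (hW₂ hB), hW.measure_inter hW₁ hW₂ hν hS hB hB1,
    ← lintegral_const_mul' _ _ (ENNReal.inv_ne_top.2 h0), withDensity_apply _ hS]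
  have e : (fun w => ENNReal.ofReal (hypCondPDF θ ν B w)) = indicator (Ioo 0 1) fun w =>
      (P (W₂ ⁻¹' B))⁻¹ * (ENNReal.ofReal (tildeJac θ.σ₁ w) *
      (ENNReal.ofReal (ghPDF (3 / 2) ν 1 (tilde θ.η₁ θ.σ₁ w)) *
        ENNReal.ofReal (ghF (transSet θ θ.ρ (tilde θ.η₁ θ.σ₁ w) B) 1 ν
          (√(1 + tilde θ.η₁ θ.σ₁ w ^ 2))))) := by
    funext w
    by_cases hw : w ∈ Ioo (0 : ℝ) 1
    · rw [hypCondPDF, indicator_of_mem hw, indicator_of_mem hw, ← tildeJac]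
      have hp := hW.measure_preimage hW₁ hW₂ hν (tilde θ.η₁ θ.σ₁ w) hB hB1
      -- Positivity of the denominator, from `P (W₂ ∈ B) ≠ 0`, lets `ENNReal.ofReal` pass through
      -- the quotient.
      have hG : 0 < ghF (transSet θ 0 (tilde θ.η₁ θ.σ₁ w) B) (3 / 2) ν 1 :=
        ENNReal.ofReal_pos.1 (hp ▸ pos_iff_ne_zero.2 h0)
      have hJ := tildeJac_pos θ.σ₁_pos hw
      have hg := ghPDF_nonneg (by norm_num : (1 : ℝ) / 2 < 3 / 2) hν one_pos (tilde θ.η₁ θ.σ₁ w)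
      rw [ENNReal.ofReal_mul (by positivity), ENNReal.ofReal_mul hJ.le,
        ENNReal.ofReal_div_of_pos hG, hp]
      simp only [div_eq_mul_inv]
      ring
    · rw [hypCondPDF, indicator_of_notMem hw, indicator_of_notMem hw, ENNReal.ofReal_zero]
  rw [e, setLIntegral_indicator measurableSet_Ioo, inter_comm]

end BULS

end

theorem mainTheorem6 {Ω : Type*} [MeasurableSpace Ω] (P : Measure Ω) [IsProbabilityMeasure P]
    (θ : BULS.Param) (ν : ℝ) (hν : 0 < ν) (W₁ W₂ : Ω → ℝ)
    (hW₁ : Measurable W₁) (hW₂ : Measurable W₂)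
    (hW : BULS.IsBULS P W₁ W₂ θ (BULS.hypGen ν)) :
    (∀ B : Set ℝ, MeasurableSet B → B ⊆ Ioo (0 : ℝ) 1 → P (W₂ ⁻¹' B) ≠ 0 →
      (ProbabilityTheory.cond P (W₂ ⁻¹' B)).map W₁ =
        (volume : Measure ℝ).withDensity fun w₁ =>
          ENNReal.ofReal (BULS.hypCondPDF θ ν B w₁)) ∧
    P.map (fun ω => BULS.tilde θ.η₁ θ.σ₁ (W₁ ω)) = BULS.ghLaw (3 / 2) ν 1 ∧
    P.map (fun ω => BULS.tilde θ.η₂ θ.σ₂ (W₂ ω)) = BULS.ghLaw (3 / 2) ν 1 ∧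
    ∀ᵐ x ∂(P.map fun ω => BULS.tilde θ.η₁ θ.σ₁ (W₁ ω)),
      condDistrib
        (fun ω => (BULS.tilde θ.η₂ θ.σ₂ (W₂ ω) - θ.ρ * BULS.tilde θ.η₁ θ.σ₁ (W₁ ω)) /
          Real.sqrt (1 - θ.ρ ^ 2))
        (fun ω => BULS.tilde θ.η₁ θ.σ₁ (W₁ ω)) P x =
      BULS.ghLaw 1 ν (Real.sqrt (1 + x ^ 2)) := by
  have h := hW.map_tilde hW₁ hW₂ hν
  exact ⟨fun B hB hB1 h0 => hW.map_cond hW₁ hW₂ hν hB hB1 h0,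
    BULS.map_fst_eq_ghLaw (by fun_prop) (by fun_prop) hν θ.ρ_mem h,
    BULS.map_fst_eq_ghLaw (by fun_prop) (by fun_prop) hν θ.ρ_mem
      (BULS.map_swap_eq (by fun_prop) (by fun_prop) hν θ.ρ_mem h),
    BULS.condDistrib_standardize (by fun_prop) (by fun_prop) hν θ.ρ_mem h⟩
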